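/- Let $\mathcal O=(\mathcal O_p)_{p\ge 0}$ be a symmetric operad in abelian groups and let $A$ be a simplicial $\mathcal O$-algebra with faces $d_i$, degeneracies $s_i$ and structure maps $\gamma:\mathcal O_p\otimes A_k^{\otimes p}\to A_k$. For $m\ge 1$ let $N_mA=\bigcap_{i=0}^{m-1}\ker(d_i:A_m\to A_{m-1})$ be the Moore complex, with differential $d$ induced by $d_m$. Fix $m\ge 2$, write $[m-1]=\{0,\dots,m-1\}$ and, for $I\subseteq[m-1]$, let $K_I=\bigcap_{i\in I}\ker(d_i:A_{m-1}\to A_{m-2})\subseteq A_{m-1}$, so that $K_\emptyset=A_{m-1}$. For $k\ge 1$ let $(G_k)$ be the condition that $A_k$ is the $\mathcal O$-subalgebra of itself generated by $\sum_{i=0}^{k-1}s_i(A_{k-1})$. Write $\gamma(\mathcal O_p\otimes K_{I_1}\otimes\dots\otimes K_{I_p})\subseteq A_{m-1}$ for the subgroup generated by the elements $\gamma(o\otimes x_1\otimes\dots\otimes x_p)$ with $o\in\mathcal O_p$, $x_i\in K_{I_i}$. (1) If $(G_m)$ holds, then $$d(N_mA)=\sum_{I}\gamma(\mathcal O_p\otimes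 K_{I_1}\otimes\dots\otimes K_{I_p}),$$ where the sum runs over all $p\ge 0$ and all tuples $I=(I_1,\dots,I_p)$ of (possibly empty) subsets $I_i\subsetneq[m-1]$ with $\bigcup_i I_i=[m-1]$. (2) Without any assumption on generation, $\gamma(\mathcal O_p\otimes K_{I_1}\otimes\dots\otimes K_{I_p})\subseteq d(N_mA)$ for every $p\ge 2$ and all nonempty $I_1,\dots,I_p\subseteq[m-1]$ with $\bigcup_i I_i=[m-1]$. (3) If $(G_k)$ holds for every $k\ge 1$, then also $$d(N_mA)=\sum_{I}\gamma(\mathcal O_p\otimes K_{I_1}\otimes\dots\otimes K_{I_p}),$$ where the sum runs over all $p\ge 1$ and all tuples $I=(I_1,\dots,I_p)$ of nonempty subsets of $[m-1]$ with $\bigcup_i I_i=[m-1]$. (4) If $\mathcal O=\mathrm{Comm}$ (with $\mathrm{Comm}_p=\mathbb Z$ for all $p\ge 0$) and $(G_m)$ holds, then $d(N_mA)=\sum K_{I'}K_{I''}$, the sum over all pairs of nonempty $I',I''\subseteq[m-1]$ with $I'\cup I''=[m-1]$, where $K_{I'}K_{I''}$ is the subgroup generated by the products $xy$ with $x\in K_{I'}$,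 $y\in K_{I''}$. -/

import Mathlib

open CategoryTheory
open scoped Simplicial

universe u v

/-- A symmetric operad in abelian groups. The symmetric group actions are packaged as the action
`map` of the groupoid of bijections between the sets `Fin n`: a bijection `Fin m ≃ Fin n` exists
only if `m = n`, and `map (finCongr h)` is the transport along `h : m = n`. The operation `map e o`
is `o` with its input `i` renamed `e i`. The structure map
`comp k : O p ⊗ O (k 0) ⊗ ⋯ ⊗ O (k (p - 1)) → O (∑ i, k i)` is given as a multi-additive map;
`finSigmaFinEquiv` lists the inputs in lexicographic order. -/
structure AbOperad where
  /-- the abelian group of operations of arity `n` -/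
  Op : ℕ → Type u
  [grp : ∀ n, AddCommGroup (Op n)]
  /-- renaming of inputs -/
  map : ∀ {m n : ℕ}, (Fin m ≃ Fin n) → Op m →+ Op n
  map_refl : ∀ {n : ℕ} (o : Op n), map (Equiv.refl (Fin n)) o = o
  map_trans : ∀ {l m n : ℕ} (e : Fin l ≃ Fin m) (f : Fin m ≃ Fin n) (o : Op l),
    map (e.trans f) o = map f (map e o)
  /-- the identity operation -/
  one : Op 1
  /-- composition of operations -/
  comp : ∀ {p : ℕ} (k : Fin p → ℕ),
    Op p →+ MultilinearMap ℤ (fun i : Fin p => Op (k i)) (Op (∑ i, k i))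
  one_comp : ∀ {n : ℕ} (h : ∑ _i : Fin 1, n = n) (o : Op n),
    map (finCongr h) (comp (fun _ : Fin 1 => n) one (fun _ => o)) = o
  comp_one : ∀ {n : ℕ} (h : ∑ _i : Fin n, 1 = n) (o : Op n),
    map (finCongr h) (comp (fun _ : Fin n => 1) o (fun _ => one)) = o
  comp_assoc : ∀ {p : ℕ} (k : Fin p → ℕ) (l : Fin (∑ i, k i) → ℕ)
    (h : ∑ s, l s = ∑ i, ∑ j, l (finSigmaFinEquiv ⟨i, j⟩))
    (o : Op p) (o' : ∀ i, Op (k i)) (o'' : ∀ s, Op (l s)),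
    map (finCongr h) (comp l (comp k o o') o'') =
      comp (fun i => ∑ j, l (finSigmaFinEquiv ⟨i, j⟩)) o
        (fun i => comp (fun j => l (finSigmaFinEquiv ⟨i, j⟩)) (o' i)
          (fun j => o'' (finSigmaFinEquiv ⟨i, j⟩)))
  /-- equivariance with respect to the outer operation -/
  comp_map_left : ∀ {p q : ℕ} (e : Fin p ≃ Fin q) (k : Fin q → ℕ) (o : Op p)
    (o' : ∀ i, Op (k i)),
    comp k (map e o) o' =
      map ((finSigmaFinEquiv.symm.trans
          (Equiv.sigmaCongrLeft (β := fun i => Fin (k i)) e)).trans finSigmaFinEquiv)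
        (comp (fun i => k (e i)) o (fun i => o' (e i)))
  /-- equivariance with respect to the inner operations -/
  comp_map_right : ∀ {p : ℕ} (k l : Fin p → ℕ) (e : ∀ i, Fin (k i) ≃ Fin (l i)) (o : Op p)
    (o' : ∀ i, Op (k i)),
    comp l o (fun i => map (e i) (o' i)) =
      map ((finSigmaFinEquiv.symm.trans (Equiv.sigmaCongrRight e)).trans finSigmaFinEquiv)
        (comp k o o')

attribute [instance] AbOperad.grp

/-- The operad of commutative algebras: `O n = ℤ` for all `n`, with trivial symmetric group actions
and with the multiplication of `ℤ` as composition. -/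
def AbOperad.Comm : AbOperad.{0} where
  Op _ := ℤ
  map _ := AddMonoidHom.id ℤ
  map_refl _ := rfl
  map_trans _ _ _ := rfl
  one := (1 : ℤ)
  comp {p} _ :=
    (LinearMap.toSpanSingleton ℤ (MultilinearMap ℤ (fun _ : Fin p => ℤ) ℤ)
      (MultilinearMap.mkPiAlgebra ℤ (Fin p) ℤ)).toAddMonoidHom
  one_comp _ _ := by simp
  comp_one _ _ := by simp
  comp_assoc k l h o o' o'' := by
    have := (Equiv.prod_comp finSigmaFinEquiv o'').symm
    simp only [Fintype.prod_sigma] at this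
    simp [Finset.prod_mul_distrib, mul_assoc, this]
  comp_map_left e k o o' := by
    simp [(Equiv.prod_comp e o').symm]
  comp_map_right _ _ _ _ _ := rfl

/-- An algebra over the operad `O`: an abelian group with an action
`act : O p ⊗ A ⊗ ⋯ ⊗ A → A` of `O`, given as a multi-additive map. -/
structure OpAlg (O : AbOperad.{u}) where
  /-- the underlying abelian group -/
  carrier : Type v
  [grp : AddCommGroup carrier]
  /-- the action of the operad -/
  act : ∀ {p : ℕ}, O.Op p →+ MultilinearMap ℤ (fun _ : Fin p => carrier) carrier
  act_one : ∀ a : Fin 1 → carrier, act O.one a = a 0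
  act_comp : ∀ {p : ℕ} (k : Fin p → ℕ) (o : O.Op p) (o' : ∀ i, O.Op (k i))
    (a : Fin (∑ i, k i) → carrier),
    act (O.comp k o o') a = act o (fun i => act (o' i) (fun j => a (finSigmaFinEquiv ⟨i, j⟩)))
  act_map : ∀ {m n : ℕ} (e : Fin m ≃ Fin n) (o : O.Op m) (a : Fin n → carrier),
    act (O.map e o) a = act o (fun i => a (e i))

namespace OpAlg

attribute [instance] OpAlg.grp

variable {O : AbOperad.{u}}

/-- Homomorphisms of `O`-algebras. -/
@[ext]
structure Hom (A B : OpAlg.{u, v} O) where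
  /-- the underlying homomorphism of abelian groups -/
  toAddHom : A.carrier →+ B.carrier
  map_act : ∀ {p : ℕ} (o : O.Op p) (a : Fin p → A.carrier),
    toAddHom (A.act o a) = B.act o (fun i => toAddHom (a i))

instance : Category (OpAlg.{u, v} O) where
  Hom A B := Hom A B
  id A := ⟨AddMonoidHom.id _, fun _ _ => rfl⟩
  comp f g := ⟨g.toAddHom.comp f.toAddHom, fun o a => by simp [f.map_act, g.map_act]⟩

/-- The subgroup `S` is a subalgebra: it is closed under all operations. -/
def IsSubalgebra (A : OpAlg.{u, v} O) (S : AddSubgroup A.carrier) : Prop :=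
  ∀ {p : ℕ} (o : O.Op p) (a : Fin p → A.carrier), (∀ i, a i ∈ S) → A.act o a ∈ S

/-- The subalgebra generated by a set. -/
def sub (A : OpAlg.{u, v} O) (X : Set A.carrier) : AddSubgroup A.carrier :=
  sInf {S | X ⊆ S ∧ A.IsSubalgebra S}

/-- `γ (O_p ⊗ S_1 ⊗ ⋯ ⊗ S_p)`: the image of the tensor product under the action, that is, the
subgroup generated by the values `γ (o ⊗ x_1 ⊗ ⋯ ⊗ x_p)` with `x_i ∈ S_i`. -/
def gammaImage (A : OpAlg.{u, v} O) {p : ℕ} (S : Fin p → AddSubgroup A.carrier) :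
    AddSubgroup A.carrier :=
  AddSubgroup.closure {y | ∃ (o : O.Op p) (x : Fin p → A.carrier),
    (∀ i, x i ∈ S i) ∧ A.act o x = y}

end OpAlg

namespace SimplicialOpAlg

variable {O : AbOperad.{u}} (A : SimplicialObject (OpAlg.{u, v} O))

/-- The face `d_i : A_{n+1} → A_n`, as a homomorphism of abelian groups. -/
def face {n : ℕ} (i : Fin (n + 2)) : (A _⦋n + 1⦌).carrier →+ (A _⦋n⦌).carrier :=
  OpAlg.Hom.toAddHom (A.δ i)

/-- The degeneracy `s_i : A_n → A_{n+1}`, as a homomorphism of abelian groups. -/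
def degen {n : ℕ} (i : Fin (n + 1)) : (A _⦋n⦌).carrier →+ (A _⦋n + 1⦌).carrier :=
  OpAlg.Hom.toAddHom (A.σ i)

/-- `A_{n+1}` is the `O`-subalgebra generated by `∑ i, s_i (A_n)`. -/
def DegenerateGenerated (n : ℕ) : Prop :=
  (A _⦋n + 1⦌).sub ((⨆ i : Fin (n + 1), (degen A i).range : AddSubgroup _) : Set _) = ⊤

/-- `K_I = ⋂_{i ∈ I} ker d_i ⊆ A_{n+1}`; in particular `K_∅ = A_{n+1}`. -/
def K {n : ℕ} (I : Finset (Fin (n + 2))) : AddSubgroup (A _⦋n + 1⦌).carrier :=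
  ⨅ i ∈ I, (face A i).ker

/-- The Moore complex in degree `n + 1`: the intersection of the kernels of all faces of
`A_{n+1}` but the last one. -/
def moore (n : ℕ) : AddSubgroup (A _⦋n + 1⦌).carrier :=
  ⨅ i : Fin (n + 1), (face A i.castSucc).ker

/-- The image in `A_n` of the differential of the Moore complex in degree `n + 1`, which is
induced by the last face. -/
def mooreBoundary (n : ℕ) : AddSubgroup (A _⦋n⦌).carrier :=
  (moore A n).map (face A (Fin.last (n + 1)))

end SimplicialOpAlg

/-! Faces commute with operations, so `d_i` kills a value of an operation as soon as it kills one
argument. For the inclusion ⊇ in (1), an element of `K_I` with `I` proper lifts along `d_m` to an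
element still killed by the faces in `I` (`exists_lift`); an operation on such lifts, with covering
index sets, lands in the Moore complex.

For ⊆, a Moore element is fixed by each `id - s_k d_k`, `k < m`. By generation it is a sum of
operations on sums of degenerate elements. Applying these maps for `k = 0, 1, …` and telescoping
over the slots arranges that every `d_k` kills some argument (`mem_degenerateSpan`). An argument
killed by all of them vanishes (`eq_zero_of_mem_degenerateFrom`), so only proper index sets survive,
and `d_m` carries the arguments into the groups `K_I`.

(2) reduces to ⊇ by shrinking index sets. In (3) the hypothesis forces `A` to be constant, so both
sides vanish. (4) follows from (1) by grouping the factors into two blocks. -/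

/-! ### Multi-additive maps: extension from generators and telescoping. -/

theorem MultilinearMap.map_mem_of_mem_closure {p : ℕ} {M N : Type*} [AddCommGroup M]
    [AddCommGroup N] (f : MultilinearMap ℤ (fun _ : Fin p => M) N) (G : Set M)
    (H : AddSubgroup N) (h : ∀ a : Fin p → M, (∀ i, a i ∈ G) → f a ∈ H) (a : Fin p → M)
    (ha : ∀ i, a i ∈ AddSubgroup.closure G) : f a ∈ H := by
  -- `s` is the set of slots already relaxed from `G` to its closure.
  suffices key : ∀ (s : Finset (Fin p)) (a : Fin p → M), (∀ i ∈ s, a i ∈ AddSubgroup.closure G) →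
      (∀ i ∉ s, a i ∈ G) → f a ∈ H from
    key Finset.univ a (fun i _ => ha i) (fun i hi => absurd (Finset.mem_univ i) hi)
  intro s
  induction s using Finset.induction_on with
  | empty => exact fun a _ ha => h a fun i => ha i (Finset.notMem_empty i)
  | insert b s hb ih =>
    intro a ha ha'
    have key : ∀ x ∈ AddSubgroup.closure G, f (Function.update a b x) ∈ H := by
      intro x hx
      induction hx using AddSubgroup.closure_induction with
      | mem x hx =>
        refine ih _ (fun i hi => ?_) (fun i hi => ?_)
        · rw [Function.update_of_ne (by rintro rfl; exact hb hi)]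
          exact ha i (Finset.mem_insert_of_mem hi)
        · rcases eq_or_ne i b with rfl | hib
          · simpa using hx
          · rw [Function.update_of_ne hib]
            exact ha' i (by simp [hib, hi])
      | zero => rw [f.map_update_zero]; exact H.zero_mem
      | add x y _ _ hx hy => rw [f.map_update_add]; exact H.add_mem hx hy
      | neg x _ hx => rw [f.map_update_neg]; exact H.neg_mem hx
    simpa using key (a b) (ha b (Finset.mem_insert_self b s))

theorem MultilinearMap.map_sub_map_mem {p : ℕ} {M N : Type*} [AddCommGroup M]
    [AddCommGroup N] (f : MultilinearMap ℤ (fun _ : Fin p => M) N) (z w : Fin p → M)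
    (H : AddSubgroup N)
    (h : ∀ (b : Fin p) (v : Fin p → M), (∀ i, v i = z i ∨ v i = w i) →
      f (Function.update v b (z b - w b)) ∈ H) : f z - f w ∈ H := by
  -- Exchange `z` for `w` one slot at a time.
  suffices key : ∀ s : Finset (Fin p), f z - f (s.piecewise w z) ∈ H by
    simpa using key Finset.univ
  intro s
  induction s using Finset.induction_on with
  | empty => simp
  | insert b s hb ih =>
    have hv : ∀ i, s.piecewise w z i = z i ∨ s.piecewise w z i = w i := fun i => by
      by_cases hi : i ∈ s <;> simp [hi]
    have := h b _ hv
    rw [f.map_update_sub] at this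
    have hz : Function.update (s.piecewise w z) b (z b) = s.piecewise w z := by
      rw [Function.update_eq_self_iff, Finset.piecewise_eq_of_notMem _ _ _ hb]
    rw [hz, ← Finset.piecewise_insert] at this
    simpa using H.add_mem ih this

/-! ### Generated subalgebras and images of operations. -/

namespace OpAlg

variable {O : AbOperad.{u}}

theorem isSubalgebra_range {A B : OpAlg.{u, v} O} (f : Hom A B) :
    B.IsSubalgebra f.toAddHom.range := by
  intro p o a ha
  choose b hb using ha
  exact ⟨A.act o b, by rw [f.map_act]; simp [hb]⟩

/-- By operadic composition, an operation applied to monomials in `X` is again a monomial, so sums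
of monomials already form a subalgebra. -/
theorem sub_le_closure (A : OpAlg.{u, v} O) (X : Set A.carrier) :
    A.sub X ≤ AddSubgroup.closure {y | ∃ (p : ℕ) (o : O.Op p) (z : Fin p → A.carrier),
      (∀ i, z i ∈ X) ∧ A.act o z = y} := by
  refine sInf_le ⟨fun x hx => AddSubgroup.subset_closure
    ⟨1, O.one, fun _ => x, fun _ => hx, A.act_one _⟩, fun o a ha => ?_⟩
  refine MultilinearMap.map_mem_of_mem_closure (A.act o) _ _ (fun a ha => ?_) a ha
  choose k o' z hz h using ha
  refine AddSubgroup.subset_closure ⟨_, O.comp k o o',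
    fun s => z (finSigmaFinEquiv.symm s).1 (finSigmaFinEquiv.symm s).2, fun s => hz _ _, ?_⟩
  rw [A.act_comp]
  have hs : ∀ s, z (finSigmaFinEquiv.symm (finSigmaFinEquiv s)).1
      (finSigmaFinEquiv.symm (finSigmaFinEquiv s)).2 = z s.1 s.2 := fun s => by
    rw [Equiv.symm_apply_apply]
  simp only [hs, h]

theorem act_mem_gammaImage (A : OpAlg.{u, v} O) {p : ℕ} (S : Fin p → AddSubgroup A.carrier)
    (o : O.Op p) (x : Fin p → A.carrier) (hx : ∀ i, x i ∈ S i) : A.act o x ∈ A.gammaImage S :=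
  AddSubgroup.subset_closure ⟨o, x, hx, rfl⟩

theorem gammaImage_le_iff (A : OpAlg.{u, v} O) {p : ℕ} (S : Fin p → AddSubgroup A.carrier)
    (H : AddSubgroup A.carrier) : A.gammaImage S ≤ H ↔
      ∀ (o : O.Op p) (x : Fin p → A.carrier), (∀ i, x i ∈ S i) → A.act o x ∈ H := by
  refine ⟨fun h o x hx => h (A.act_mem_gammaImage S o x hx), fun h => ?_⟩
  refine (AddSubgroup.closure_le _).2 ?_
  rintro _ ⟨o, x, hx, rfl⟩
  exact h o x hx

/-- Over `Comm`, a product can be computed blockwise. -/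
theorem comm_act_eq_act_blocks (A : OpAlg.{0, v} AbOperad.Comm) {n p : ℕ} (k : Fin p → ℕ)
    (f : (Σ i, Fin (k i)) ≃ Fin n) (c : ℤ) (x : Fin n → A.carrier) :
    A.act (p := n) (show AbOperad.Comm.Op n from c) x =
      A.act (p := p) (show AbOperad.Comm.Op p from c) fun i =>
        A.act (p := k i) (show AbOperad.Comm.Op (k i) from (1 : ℤ)) fun j => x (f ⟨i, j⟩) := by
  have h := A.act_comp k (show AbOperad.Comm.Op p from c) (fun _ => (1 : ℤ))
    (fun s => x (f (finSigmaFinEquiv.symm s)))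
  have h' := A.act_map (finSigmaFinEquiv.symm.trans f)
    (AbOperad.Comm.comp k (show AbOperad.Comm.Op p from c) fun _ => (1 : ℤ)) x
  simp only [Equiv.symm_apply_apply] at h
  have hc : AbOperad.Comm.comp k (show AbOperad.Comm.Op p from c) (fun _ => (1 : ℤ)) = c := by
    change c • ∏ _i : Fin p, (1 : ℤ) = c
    simp
  refine Eq.trans ?_ (h'.trans h)
  rw [hc]
  rfl

end OpAlg

/-! ### Simplicial identities. -/

namespace SimplicialOpAlg

variable {O : AbOperad.{u}} (A : SimplicialObject (OpAlg.{u, v} O))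

theorem face_act {n p : ℕ} (i : Fin (n + 2)) (o : O.Op p)
    (a : Fin p → (A _⦋n + 1⦌).carrier) :
    face A i ((A _⦋n + 1⦌).act o a) = (A _⦋n⦌).act o fun j => face A i (a j) :=
  OpAlg.Hom.map_act (A.δ i) o a

theorem degen_act {n p : ℕ} (i : Fin (n + 1)) (o : O.Op p) (a : Fin p → (A _⦋n⦌).carrier) :
    degen A i ((A _⦋n⦌).act o a) = (A _⦋n + 1⦌).act o fun j => degen A i (a j) :=
  OpAlg.Hom.map_act (A.σ i) o a

theorem hom_congr {B C : OpAlg.{u, v} O} {f g : B ⟶ C} (h : f = g) (x : B.carrier) :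
    OpAlg.Hom.toAddHom f x = OpAlg.Hom.toAddHom g x := by rw [h]

theorem face_face {n : ℕ} {i j : Fin (n + 2)} (h : i ≤ j) (x : (A _⦋n + 2⦌).carrier) :
    face A i (face A j.succ x) = face A j (face A i.castSucc x) :=
  hom_congr (A.δ_comp_δ h) x

theorem face_degen_of_le {n : ℕ} {i : Fin (n + 2)} {j : Fin (n + 1)} (h : i ≤ j.castSucc)
    (x : (A _⦋n + 1⦌).carrier) :
    face A i.castSucc (degen A j.succ x) = degen A j (face A i x) :=
  hom_congr (A.δ_comp_σ_of_le h) x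

theorem face_degen_self {n : ℕ} (i : Fin (n + 1)) (x : (A _⦋n⦌).carrier) :
    face A i.castSucc (degen A i x) = x :=
  hom_congr (A.δ_comp_σ_self (i := i)) x

theorem face_degen_succ {n : ℕ} (i : Fin (n + 1)) (x : (A _⦋n⦌).carrier) :
    face A i.succ (degen A i x) = x :=
  hom_congr (A.δ_comp_σ_succ (i := i)) x

theorem face_degen_of_gt {n : ℕ} {i : Fin (n + 2)} {j : Fin (n + 1)} (h : j.castSucc < i)
    (x : (A _⦋n + 1⦌).carrier) :
    face A i.succ (degen A j.castSucc x) = degen A j (face A i x) :=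
  hom_congr (A.δ_comp_σ_of_gt h) x

theorem degen_degen {n : ℕ} {i j : Fin (n + 1)} (h : i ≤ j) (x : (A _⦋n⦌).carrier) :
    degen A i.castSucc (degen A j x) = degen A j.succ (degen A i x) :=
  hom_congr (A.σ_comp_σ h) x

variable {A}

theorem mem_K {n : ℕ} {I : Finset (Fin (n + 2))} {x : (A _⦋n + 1⦌).carrier} :
    x ∈ K A I ↔ ∀ i ∈ I, face A i x = 0 := by
  simp [K, AddSubgroup.mem_iInf, AddMonoidHom.mem_ker]

theorem mem_moore {n : ℕ} {x : (A _⦋n + 1⦌).carrier} :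
    x ∈ moore A n ↔ ∀ i : Fin (n + 1), face A i.castSucc x = 0 := by
  simp [moore, AddSubgroup.mem_iInf, AddMonoidHom.mem_ker]

theorem face_act_eq_zero {n p : ℕ} (i : Fin (n + 2)) (o : O.Op p)
    (a : Fin p → (A _⦋n + 1⦌).carrier) (j : Fin p) (h : face A i (a j) = 0) :
    face A i ((A _⦋n + 1⦌).act o a) = 0 := by
  rw [face_act]
  exact MultilinearMap.map_coord_zero _ j h

/-! ### Lifting along the last face; the inclusion ⊇ and part (2). -/

/-- Elements of `K_I`, for `I` a proper subset, lift along the last face to elements killed by the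
faces in `I`. -/
theorem exists_lift {n : ℕ} {I : Finset (Fin (n + 2))} (hI : I ≠ Finset.univ)
    {x : (A _⦋n + 1⦌).carrier} (hx : x ∈ K A I) :
    ∃ y : (A _⦋n + 2⦌).carrier, face A (Fin.last (n + 2)) y = x ∧
      ∀ i ∈ I, face A i.castSucc y = 0 := by
  rw [mem_K] at hx
  -- Downward induction on the one face `t` allowed to fail, starting from `s_{n+1} x`. Subtracting
  -- `s_t d_{t+1} y` repairs face `t + 1` and can spoil only face `t`; the last face is unchanged
  -- because `d_{t+1} x = 0`. Finally `t` is the largest index outside `I`, where nothing is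
  -- required.
  have key : ∀ t : Fin (n + 2), (∀ i, t < i → i ∈ I) →
      ∃ y : (A _⦋n + 2⦌).carrier, face A (Fin.last (n + 2)) y = x ∧
        ∀ i ∈ I, i ≠ t → face A i.castSucc y = 0 := by
    intro t
    induction t using Fin.reverseInduction with
    | last =>
      refine fun _ => ⟨degen A (Fin.last (n + 1)) x, face_degen_succ A (Fin.last (n + 1)) x,
        fun i hi hne => ?_⟩
      have := face_degen_of_le A (i := i) (j := Fin.last n)
        (by simp only [ne_eq, Fin.ext_iff, Fin.le_def, Fin.val_castSucc, Fin.val_last] at hne ⊢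
            omega) x
      rw [Fin.succ_last] at this
      rw [this, hx i hi, map_zero]
    | cast t ih =>
      intro ht
      obtain ⟨y, hy, hyI⟩ := ih fun i hi => ht i (lt_trans Fin.castSucc_lt_succ hi)
      have hgt : ∀ j : Fin (n + 2), t.succ ≤ j →
          face A j.succ (degen A t.castSucc (face A t.succ.castSucc y)) =
            degen A t (face A t.succ (face A j.succ y)) := fun j hj => by
        rw [face_degen_of_gt A (lt_of_lt_of_le Fin.castSucc_lt_succ hj), face_face A hj]
      refine ⟨y - degen A t.castSucc (face A t.succ.castSucc y), ?_, fun i hi hne => ?_⟩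
      · have := hgt (Fin.last (n + 1)) (Fin.le_last _)
        rw [Fin.succ_last] at this
        rw [map_sub, this, hy, hx _ (ht _ Fin.castSucc_lt_succ), map_zero, sub_zero]
      · rw [map_sub]
        rcases lt_trichotomy i t.succ with h | rfl | h
        · have hit : i < t.castSucc := lt_of_le_of_ne (Fin.le_castSucc_iff.2 h) hne
          obtain ⟨t', ht'⟩ := Fin.exists_succ_eq.2 (Fin.ne_zero_of_lt hit)
          rw [hyI i hi h.ne, ← ht', face_degen_of_le A (Fin.le_castSucc_iff.2 (ht' ▸ hit)),
            ← Fin.succ_castSucc, face_face A hit.le, hyI i hi h.ne, map_zero, map_zero, sub_zero]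
        · have := face_degen_succ A t.castSucc (face A t.succ.castSucc y)
          rw [Fin.succ_castSucc] at this
          rw [this, sub_self]
        · obtain ⟨j, rfl⟩ := Fin.exists_succ_eq.2 (Fin.ne_zero_of_lt h)
          have := hgt j.castSucc (Fin.le_castSucc_iff.2 h)
          rw [Fin.succ_castSucc] at this
          rw [this, hyI _ hi h.ne', map_zero, map_zero, sub_zero]
  have hne : (Iᶜ).Nonempty := by
    rwa [Finset.nonempty_iff_ne_empty, ne_eq, Finset.compl_eq_empty_iff]
  obtain ⟨y, hy, hyI⟩ := key ((Iᶜ).max' hne) fun i hi => by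
    by_contra h
    exact absurd ((Iᶜ).le_max' i (Finset.mem_compl.2 h)) (not_le.2 hi)
  refine ⟨y, hy, fun i hi => hyI i hi ?_⟩
  rintro rfl
  exact Finset.mem_compl.1 ((Iᶜ).max'_mem hne) hi

theorem gammaImage_le_mooreBoundary {n p : ℕ} (I : Fin p → Finset (Fin (n + 2)))
    (hI : ∀ i, I i ≠ Finset.univ) (hcov : Finset.univ.biUnion I = Finset.univ) :
    (A _⦋n + 1⦌).gammaImage (fun i => K A (I i)) ≤ mooreBoundary A (n + 1) := by
  rw [OpAlg.gammaImage_le_iff]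
  intro o x hx
  choose y hy hyI using fun i => exists_lift (hI i) (hx i)
  refine ⟨(A _⦋n + 2⦌).act o y, mem_moore.2 fun j => ?_, ?_⟩
  · obtain ⟨i, -, hi⟩ := Finset.mem_biUnion.1 (hcov ▸ Finset.mem_univ j)
    exact face_act_eq_zero _ o y i (hyI i j hi)
  · exact (face_act A _ o y).trans (by simp only [hy])

theorem K_anti {n : ℕ} {I J : Finset (Fin (n + 2))} (h : I ⊆ J) : K A J ≤ K A I :=
  fun _ hx => mem_K.2 fun i hi => mem_K.1 hx i (h hi)

theorem gammaImage_mono_K {n p : ℕ} {I J : Fin p → Finset (Fin (n + 2))} (h : ∀ i, I i ⊆ J i) :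
    (A _⦋n + 1⦌).gammaImage (fun i => K A (J i)) ≤
      (A _⦋n + 1⦌).gammaImage (fun i => K A (I i)) :=
  (OpAlg.gammaImage_le_iff _ _ _).2 fun o x hx =>
    OpAlg.act_mem_gammaImage _ _ o x fun i => K_anti (h i) (hx i)

theorem gammaImage_le_mooreBoundary_of_nonempty {n p : ℕ} (I : Fin p → Finset (Fin (n + 2)))
    (hp : 2 ≤ p) (hI : ∀ i, (I i).Nonempty) (hcov : Finset.univ.biUnion I = Finset.univ) :
    (A _⦋n + 1⦌).gammaImage (fun i => K A (I i)) ≤ mooreBoundary A (n + 1) := by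
  by_cases hfull : ∀ i, I i ≠ Finset.univ
  · exact gammaImage_le_mooreBoundary I hfull hcov
  push Not at hfull
  obtain ⟨a, ha⟩ := hfull
  have : Nontrivial (Fin p) := Fin.nontrivial_iff_two_le.2 hp
  obtain ⟨b, hb⟩ := exists_ne a
  obtain ⟨t, ht⟩ := hI b
  -- Two slots already cover everything; all these sets are proper because there are at least two
  -- indices.
  let J : Fin p → Finset (Fin (n + 2)) := fun i => if i = a then {t}ᶜ else if i = b then {t} else ∅
  have hJ : ∀ i, J i ⊆ I i := fun i => by
    by_cases h : i = a
    · subst h; simp [ha]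
    · by_cases h' : i = b
      · subst h'; simpa [J, h] using ht
      · simp [J, h, h']
  refine (gammaImage_mono_K hJ).trans (gammaImage_le_mooreBoundary J (fun i => ?_) ?_)
  · obtain ⟨s, hs⟩ := exists_ne t
    rw [ne_eq, Finset.eq_univ_iff_forall, not_forall]
    by_cases h : i = a
    · exact ⟨t, by simp [J, h]⟩
    · refine ⟨s, ?_⟩
      by_cases h' : i = b
      · simp [J, h', hb, hs]
      · simp [J, h, h']
  · ext j
    simp only [Finset.mem_biUnion, Finset.mem_univ, true_and, iff_true]
    by_cases h : j = t
    · exact ⟨b, by simp [J, hb, h]⟩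
    · exact ⟨a, by simp [J, h]⟩

/-! ### The maps `id - s_k d_k`; the inclusion ⊆ of (1). -/

theorem face_degen_face_eq_zero {n : ℕ} {i k : Fin (n + 2)} (h : i < k)
    {z : (A _⦋n + 2⦌).carrier} (hz : face A i.castSucc z = 0) :
    face A i.castSucc (degen A k (face A k.castSucc z)) = 0 := by
  obtain ⟨k, rfl⟩ := Fin.exists_succ_eq.2 (Fin.ne_zero_of_lt h)
  have hik := Fin.le_castSucc_iff.2 h
  rw [face_degen_of_le A hik, ← Fin.succ_castSucc, face_face A hik, hz, map_zero, map_zero]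

variable (A) in
/-- The subgroup of `A_{n+1}` generated by the images of the degeneracies `s_j` with `k ≤ j`. -/
def degenerateFrom (n k : ℕ) : AddSubgroup (A _⦋n + 1⦌).carrier :=
  ⨆ (j : Fin (n + 1)) (_ : k ≤ (j : ℕ)), (degen A j).range

theorem degen_mem_degenerateFrom {n k : ℕ} (j : Fin (n + 1)) (h : k ≤ (j : ℕ))
    (x : (A _⦋n⦌).carrier) : degen A j x ∈ degenerateFrom A n k :=
  le_iSup₂ (f := fun (j : Fin (n + 1)) (_ : k ≤ (j : ℕ)) => (degen A j).range) j h ⟨x, rfl⟩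

/-- `id - s_k d_k` annihilates the image of `s_k`, and for `j > k` it preserves that of `s_j`, since
`s_k d_k s_j = s_k s_{j-1} d_k = s_j s_k d_k`. -/
theorem sub_degen_face_mem {n : ℕ} (k : Fin (n + 2)) {z : (A _⦋n + 2⦌).carrier}
    (hz : z ∈ degenerateFrom A (n + 1) k) :
    z - degen A k (face A k.castSucc z) ∈ degenerateFrom A (n + 1) (k + 1) := by
  let f : (A _⦋n + 2⦌).carrier →+ (A _⦋n + 2⦌).carrier :=
    AddMonoidHom.id _ - (degen A k).comp (face A k.castSucc)
  suffices h : degenerateFrom A (n + 1) k ≤ (degenerateFrom A (n + 1) (k + 1)).comap f from h hz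
  refine iSup₂_le fun j hj => ?_
  rintro _ ⟨x, rfl⟩
  change degen A j x - degen A k (face A k.castSucc (degen A j x)) ∈
    degenerateFrom A (n + 1) (k + 1)
  rcases eq_or_lt_of_le (Fin.le_def.2 hj) with rfl | h
  · rw [face_degen_self, sub_self]
    exact zero_mem _
  · obtain ⟨j, rfl⟩ := Fin.exists_succ_eq.2 (Fin.ne_zero_of_lt h)
    have hkj := Fin.le_castSucc_iff.2 h
    obtain ⟨k, rfl⟩ := Fin.exists_castSucc_eq.2 (Fin.ne_last_of_lt h)
    rw [face_degen_of_le A hkj, degen_degen A (Fin.castSucc_le_castSucc_iff.1 hkj)]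
    exact sub_mem (degen_mem_degenerateFrom _ (Fin.lt_def.1 h) _)
      (degen_mem_degenerateFrom _ (Fin.lt_def.1 h) _)

/-- A sum of degenerate elements in the Moore complex vanishes. -/
theorem eq_zero_of_mem_degenerateFrom {n : ℕ} {z : (A _⦋n + 2⦌).carrier}
    (hz : z ∈ degenerateFrom A (n + 1) 0) (hz' : z ∈ moore A (n + 1)) : z = 0 := by
  rw [mem_moore] at hz'
  have key : ∀ k ≤ n + 2, z ∈ degenerateFrom A (n + 1) k := by
    intro k
    induction k with
    | zero => exact fun _ => hz
    | succ k ih =>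
      intro hk
      have := sub_degen_face_mem (A := A) ⟨k, hk⟩ (ih (by omega))
      rwa [hz', map_zero, sub_zero] at this
  have hbot : degenerateFrom A (n + 1) (n + 2) = ⊥ :=
    iSup₂_eq_bot.2 fun j hj => absurd j.isLt (not_lt.2 hj)
  have := key (n + 2) le_rfl
  rwa [hbot, AddSubgroup.mem_bot] at this

variable (A) in
/-- The subgroup generated by the values of operations on sums of degenerate elements such that
each of the faces `d_j` with `j < k` kills one of the arguments. -/
def degenerateSpan (n k : ℕ) : AddSubgroup (A _⦋n + 2⦌).carrier :=
  AddSubgroup.closure {y | ∃ (p : ℕ) (o : O.Op p) (z : Fin p → (A _⦋n + 2⦌).carrier),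
    (∀ i, z i ∈ degenerateFrom A (n + 1) 0) ∧
    (∀ j : Fin (n + 2), (j : ℕ) < k → ∃ i, face A j.castSucc (z i) = 0) ∧
    (A _⦋n + 2⦌).act o z = y}

/-- Each telescoping term has `z_b - s_k d_k z_b` in one slot, which `d_k` kills. Elsewhere it has
`z_i` or `s_k d_k z_i`, and a face `d_j` with `j < k` that kills `z_i` kills both, so earlier
progress is kept. -/
theorem sub_degen_face_mem_degenerateSpan {n : ℕ} (k : Fin (n + 2)) {y : (A _⦋n + 2⦌).carrier}
    (hy : y ∈ degenerateSpan A n k) :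
    y - degen A k (face A k.castSucc y) ∈ degenerateSpan A n (k + 1) := by
  let f : (A _⦋n + 2⦌).carrier →+ (A _⦋n + 2⦌).carrier :=
    AddMonoidHom.id _ - (degen A k).comp (face A k.castSucc)
  suffices h : degenerateSpan A n k ≤ (degenerateSpan A n (k + 1)).comap f from h hy
  refine (AddSubgroup.closure_le _).2 ?_
  rintro _ ⟨p, o, z, hz, hzk, rfl⟩
  change (A _⦋n + 2⦌).act o z -
    degen A k (face A k.castSucc ((A _⦋n + 2⦌).act o z)) ∈ degenerateSpan A n (k + 1)
  rw [face_act, degen_act]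
  refine MultilinearMap.map_sub_map_mem _ _ _ _ fun b v hv => AddSubgroup.subset_closure
    ⟨p, o, _, fun i => ?_, fun j hj => ?_, rfl⟩
  · have hd : ∀ x, degen A k x ∈ degenerateFrom A (n + 1) 0 :=
      degen_mem_degenerateFrom k (Nat.zero_le _)
    rcases eq_or_ne i b with rfl | hib
    · rw [Function.update_self]
      exact sub_mem (hz i) (hd _)
    · rw [Function.update_of_ne hib]
      rcases hv i with h | h <;> rw [h]
      exacts [hz i, hd _]
  · rcases eq_or_lt_of_le (Nat.lt_succ_iff.1 hj) with h | h
    · obtain rfl := Fin.ext h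
      exact ⟨b, by rw [Function.update_self, map_sub, face_degen_self, sub_self]⟩
    · obtain ⟨i, hi⟩ := hzk j h
      have hi' := face_degen_face_eq_zero (Fin.lt_def.2 h) hi
      refine ⟨i, ?_⟩
      rcases eq_or_ne i b with rfl | hib
      · rw [Function.update_self, map_sub, hi, hi', sub_zero]
      · rw [Function.update_of_ne hib]
        rcases hv i with h | h <;> rw [h]
        exacts [hi, hi']

theorem mem_degenerateSpan {n : ℕ} (hG : DegenerateGenerated A (n + 1))
    {y : (A _⦋n + 2⦌).carrier} (hy : y ∈ moore A (n + 1)) : y ∈ degenerateSpan A n (n + 2) := by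
  rw [mem_moore] at hy
  suffices key : ∀ k ≤ n + 2, y ∈ degenerateSpan A n k from key _ le_rfl
  intro k
  induction k with
  | zero =>
    intro _
    have : y ∈ (A _⦋n + 2⦌).sub _ := (SetLike.ext_iff.1 hG y).2 trivial
    refine AddSubgroup.closure_mono ?_ (OpAlg.sub_le_closure _ _ this)
    rintro _ ⟨p, o, z, hz, rfl⟩
    exact ⟨p, o, z, by simpa [degenerateFrom] using hz, by simp, rfl⟩
  | succ k ih =>
    intro hk
    have := sub_degen_face_mem_degenerateSpan (A := A) ⟨k, hk⟩ (ih (by omega))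
    rwa [hy, map_zero, sub_zero] at this

theorem mooreBoundary_eq_of_degenerateGenerated {n : ℕ} (hG : DegenerateGenerated A (n + 1)) :
    mooreBoundary A (n + 1) =
      ⨆ (p : ℕ) (I : Fin p → Finset (Fin (n + 2)))
        (_ : (∀ i, I i ≠ Finset.univ) ∧ Finset.univ.biUnion I = Finset.univ),
        (A _⦋n + 1⦌).gammaImage (fun i => K A (I i)) := by
  classical
  refine le_antisymm ?_ (iSup_le fun p => iSup₂_le fun I hI =>
    gammaImage_le_mooreBoundary I hI.1 hI.2)
  refine (AddSubgroup.map_mono fun y hy => mem_degenerateSpan hG hy).trans ?_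
  rw [AddSubgroup.map_le_iff_le_comap]
  refine (AddSubgroup.closure_le _).2 ?_
  rintro _ ⟨p, o, z, hz, hzk, rfl⟩
  rw [SetLike.mem_coe, AddSubgroup.mem_comap, face_act]
  by_cases h0 : ∃ i, z i = 0
  · obtain ⟨i, hi⟩ := h0
    rw [MultilinearMap.map_coord_zero _ i (by rw [hi, map_zero])]
    exact zero_mem _
  push Not at h0
  let I : Fin p → Finset (Fin (n + 2)) := fun i => {j | face A j.castSucc (z i) = 0}
  -- A full index set would put a sum of degenerate elements into the Moore complex, forcing that
  -- argument to be zero.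
  have hI : ∀ i, I i ≠ Finset.univ := fun i hi => h0 i <|
    eq_zero_of_mem_degenerateFrom (hz i) <| mem_moore.2 fun j => by
      have : j ∈ I i := hi ▸ Finset.mem_univ j
      simpa [I] using this
  have hcov : Finset.univ.biUnion I = Finset.univ := by
    ext j
    simpa [I] using hzk j j.isLt
  refine AddSubgroup.mem_iSup_of_mem p (AddSubgroup.mem_iSup_of_mem I
    (AddSubgroup.mem_iSup_of_mem ⟨hI, hcov⟩ (OpAlg.act_mem_gammaImage _ _ o _ fun i =>
      mem_K.2 fun j hj => ?_)))
  have hj' : face A j.castSucc (z i) = 0 := by simpa [I] using hj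
  -- `d_j d_m = d_{m-1} d_j` for `j < m`.
  rw [← Fin.succ_last, face_face A (Fin.le_last j), hj', map_zero]

/-! ### Generation in all degrees; part (3). -/

/-- If all `A_k` with `k ≥ 1` are generated by degenerate elements, then `A` is constant. -/
theorem degen_surjective (hG : ∀ k : ℕ, DegenerateGenerated A k) (n : ℕ) (i : Fin (n + 1)) :
    Function.Surjective (degen A i) := by
  suffices key : ∀ n, (∀ i j : Fin (n + 1), (degen A i).range ≤ (degen A j).range) →
      ∀ i : Fin (n + 1), Function.Surjective (degen A i) by
    refine key n ?_ i
    clear i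
    induction n with
    | zero => exact fun i j => by rw [Fin.fin_one_eq_zero i, Fin.fin_one_eq_zero j]
    | succ n ih =>
      have hs := key n ih
      -- One degree lower `s_i` is surjective, so `s_i s_i = s_{i+1} s_i` identifies neighbouring
      -- ranges.
      have h0 : ∀ i : Fin (n + 2), (degen A i).range = (degen A 0).range := by
        intro i
        induction i using Fin.induction with
        | zero => rfl
        | succ i hi =>
          rw [← hi]
          ext x
          constructor
          · rintro ⟨y, rfl⟩
            obtain ⟨w, rfl⟩ := hs i y
            exact ⟨degen A i w, degen_degen A le_rfl w⟩
          · rintro ⟨y, rfl⟩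
            obtain ⟨w, rfl⟩ := hs i y
            exact ⟨degen A i w, (degen_degen A le_rfl w).symm⟩
      exact fun i j => ((h0 i).trans (h0 j).symm).le
  intro n h i
  rw [← AddMonoidHom.range_eq_top, eq_top_iff, ← hG n]
  -- The range of `s_i` is a subalgebra containing all the generators.
  exact sInf_le ⟨SetLike.coe_subset_coe.2 (iSup_le fun j => h j i), OpAlg.isSubalgebra_range (A.σ i)⟩

theorem face_injective (hG : ∀ k : ℕ, DegenerateGenerated A k) {n : ℕ} (i : Fin (n + 2)) :
    Function.Injective (face A i) := by
  obtain ⟨j, hj⟩ : ∃ j : Fin (n + 1), Function.LeftInverse (face A i) (degen A j) := by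
    induction i using Fin.lastCases with
    | last => exact ⟨Fin.last n, face_degen_succ A (Fin.last n)⟩
    | cast j => exact ⟨j, face_degen_self A j⟩
  exact (hj.rightInverse_of_surjective (degen_surjective hG n j)).injective

theorem mooreBoundary_eq_of_forall_degenerateGenerated (hG : ∀ k : ℕ, DegenerateGenerated A k)
    (n : ℕ) : mooreBoundary A (n + 1) =
      ⨆ (p : ℕ) (I : Fin p → Finset (Fin (n + 2)))
        (_ : (∀ i, (I i).Nonempty) ∧ Finset.univ.biUnion I = Finset.univ),
        (A _⦋n + 1⦌).gammaImage (fun i => K A (I i)) := by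
  have h0 : ∀ {n : ℕ} (i : Fin (n + 2)) {x}, face A i x = 0 → x = 0 := fun i x hx =>
    face_injective hG i (hx.trans (map_zero _).symm)
  trans ⊥
  · refine (AddSubgroup.map_eq_bot_iff _).2 fun x hx => ?_
    rw [h0 _ (mem_moore.1 hx 0)]
    exact zero_mem _
  · refine (eq_bot_iff.2 (iSup_le fun p => iSup₂_le fun I hI => ?_)).symm
    rw [OpAlg.gammaImage_le_iff]
    intro o x hx
    -- Covering a nonempty set rules out `p = 0`.
    obtain ⟨i, -, -⟩ := Finset.mem_biUnion.1 (hI.2 ▸ Finset.mem_univ 0)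
    obtain ⟨j, hj⟩ := hI.1 i
    exact MultilinearMap.map_coord_zero _ i (h0 j (mem_K.1 (hx i) j hj))

/-! ### Commutative algebras; part (4). -/

theorem mooreBoundary_eq_of_comm (B : SimplicialObject (OpAlg.{0, v} AbOperad.Comm)) (n : ℕ)
    (hG : DegenerateGenerated B (n + 1)) :
    mooreBoundary B (n + 1) =
      ⨆ (I : Fin 2 → Finset (Fin (n + 2)))
        (_ : (∀ i, (I i).Nonempty) ∧ Finset.univ.biUnion I = Finset.univ),
        (B _⦋n + 1⦌).gammaImage (fun i => K B (I i)) := by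
  refine le_antisymm ?_ (iSup₂_le fun I hI =>
    gammaImage_le_mooreBoundary_of_nonempty I le_rfl hI.1 hI.2)
  rw [mooreBoundary_eq_of_degenerateGenerated hG]
  refine iSup_le fun p => iSup₂_le fun I hI => ?_
  rw [OpAlg.gammaImage_le_iff]
  intro c x hx
  obtain ⟨hI, hcov⟩ := hI
  have hmem : ∀ t, ∃ j, t ∈ I j := fun t => by
    simpa using hcov.ge (Finset.mem_univ t)
  obtain ⟨a, ha⟩ := hmem 0
  -- The factor `a` alone against all others: the first block covers the index `0`, and the second
  -- must cover what the proper set `I a` misses, so both index sets are nonempty.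
  let g : Fin p → Fin 2 := fun j => if j = a then 0 else 1
  let J : Fin 2 → Finset (Fin (n + 2)) := fun i => (Finset.univ.filter (g · = i)).biUnion I
  have hJ : ∀ {i t}, t ∈ J i ↔ ∃ j, g j = i ∧ t ∈ I j := by simp [J]
  have hJne : ∀ i, (J i).Nonempty := by
    refine Fin.forall_fin_two.2 ⟨⟨0, hJ.2 ⟨a, by simp [g], ha⟩⟩, ?_⟩
    obtain ⟨t, ht⟩ := not_forall.1 (mt Finset.eq_univ_iff_forall.2 (hI a))
    obtain ⟨j, hj⟩ := hmem t
    exact ⟨t, hJ.2 ⟨j, if_neg (by rintro rfl; exact ht hj), hj⟩⟩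
  have hJcov : Finset.univ.biUnion J = Finset.univ := by
    ext t
    obtain ⟨j, hj⟩ := hmem t
    simp only [Finset.mem_biUnion, Finset.mem_univ, true_and, iff_true]
    exact ⟨g j, hJ.2 ⟨j, rfl, hj⟩⟩
  refine AddSubgroup.mem_iSup_of_mem J (AddSubgroup.mem_iSup_of_mem ⟨hJne, hJcov⟩ ?_)
  let e : ∀ i, Fin (Fintype.card {j // g j = i}) ≃ {j // g j = i} := fun i =>
    (Fintype.equivFin _).symm
  rw [OpAlg.comm_act_eq_act_blocks _ (fun i => Fintype.card {j // g j = i})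
    ((Equiv.sigmaCongrRight e).trans (Equiv.sigmaFiberEquiv g)) c x]
  refine OpAlg.act_mem_gammaImage _ _ _ _ fun i => mem_K.2 fun t ht => ?_
  obtain ⟨j, hj, htj⟩ := hJ.1 ht
  refine face_act_eq_zero t _ _ ((e i).symm ⟨j, hj⟩) ?_
  simpa using mem_K.1 (hx j) t htj

end SimplicialOpAlg

open SimplicialOpAlg in
theorem theorem4 (O : AbOperad.{u}) (A : SimplicialObject (OpAlg.{u, v} O)) :
    -- `m = n + 2`, and only `A_m` is assumed to be generated by degenerate elements
    (∀ n : ℕ, DegenerateGenerated A (n + 1) →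
      mooreBoundary A (n + 1) =
        ⨆ (p : ℕ) (I : Fin p → Finset (Fin (n + 2)))
          (_ : (∀ i, I i ≠ Finset.univ) ∧ Finset.univ.biUnion I = Finset.univ),
          (A _⦋n + 1⦌).gammaImage (fun i => K A (I i))) ∧
    -- nonempty index sets, no assumption on generation
    (∀ (n p : ℕ) (I : Fin p → Finset (Fin (n + 2))), 2 ≤ p → (∀ i, (I i).Nonempty) →
      Finset.univ.biUnion I = Finset.univ →
        (A _⦋n + 1⦌).gammaImage (fun i => K A (I i)) ≤ mooreBoundary A (n + 1)) ∧
    -- every `A_k` with `k ≥ 1` is generated by degenerate elements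
    ((∀ k : ℕ, DegenerateGenerated A k) → ∀ n : ℕ,
      mooreBoundary A (n + 1) =
        ⨆ (p : ℕ) (I : Fin p → Finset (Fin (n + 2)))
          (_ : (∀ i, (I i).Nonempty) ∧ Finset.univ.biUnion I = Finset.univ),
          (A _⦋n + 1⦌).gammaImage (fun i => K A (I i))) ∧
    -- the case of commutative algebras: pairs of nonempty index sets suffice
    (∀ (B : SimplicialObject (OpAlg.{0, v} AbOperad.Comm)) (n : ℕ),
      DegenerateGenerated B (n + 1) →
        mooreBoundary B (n + 1) =
          ⨆ (I : Fin 2 → Finset (Fin (n + 2)))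
            (_ : (∀ i, (I i).Nonempty) ∧ Finset.univ.biUnion I = Finset.univ),
            (B _⦋n + 1⦌).gammaImage (fun i => K B (I i))) :=
  ⟨fun _ hG => mooreBoundary_eq_of_degenerateGenerated hG,
    fun _ _ I hp hI hcov => gammaImage_le_mooreBoundary_of_nonempty I hp hI hcov,
    mooreBoundary_eq_of_forall_degenerateGenerated, mooreBoundary_eq_of_comm⟩
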